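/- Let $K$ be an algebraically closed field (of any characteristic), let $B_3=\langle\sigma_1,\sigma_2\mid\sigma_1\sigma_2\sigma_1=\sigma_2\sigma_1\sigma_2\rangle$ be the braid group on three strands, and put $\zeta=(\sigma_1\sigma_2)^3$. Let $\pi:B_3\to SL(2,\mathbb Z)$ be the homomorphism with $\sigma_1\mapsto\begin{pmatrix}1&1\\0&1\end{pmatrix}$, $\sigma_2\mapsto\begin{pmatrix}1&0\\-1&1\end{pmatrix}$, and let $\bar\pi:B_3\to PSL(2,\mathbb Z)=SL(2,\mathbb Z)/\{\pm1\}$ be its composition with the projection. All modules are finite-dimensional over $K$. On every simple $B_3$-module $V$ of dimension $d$ the element $\zeta$ acts as multiplication by a unique scalar $\delta\in K$, and $\delta^d=\det(A)^6$, where $A$ is the endomorphism by which $\sigma_1$ acts on $V$. Moreover: (a) On each $K$-vector space $V$ of finite dimension (in particular of dimension $\le 5$), restriction along $\pi$ is a bijection from the simple $SL(2,\mathbb Z)$-module structures on $V$ onto the simple $B_3$-module structures on $V$ with $\delta^2=1$. Two $SL(2,\mathbb Z)$-modules are isomorphic if and only if their restrictions along $\pi$ are isomorphic $B_3$-modules.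 (b) On each such $V$, restriction along $\bar\pi$ is a bijection from the simple $PSL(2,\mathbb Z)$-module structures on $V$ onto the simple $B_3$-module structures on $V$ with $\delta=1$. Two $PSL(2,\mathbb Z)$-modules are isomorphic if and only if their restrictions along $\bar\pi$ are isomorphic $B_3$-modules. (c) Let $V$ be a simple $B_3$-module of dimension $d$, and let $\lambda_1,\dots,\lambda_d$ be the eigenvalues of $A$, listed with algebraic multiplicity. If $d=2$, then $\delta=-(\lambda_1\lambda_2)^3$; if $d=3$, then $\delta=(\lambda_1\lambda_2\lambda_3)^2$. -/

import Mathlib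

open scoped MatrixGroups

namespace B3Rep

/-- The single defining relator `σ₁σ₂σ₁(σ₂σ₁σ₂)⁻¹` of `B₃`; `σ₁` is the generator `0`, `σ₂` the
generator `1`. -/
def braidRels : Set (FreeGroup (Fin 2)) :=
  {FreeGroup.of 0 * FreeGroup.of 1 * FreeGroup.of 0 *
    (FreeGroup.of 1 * FreeGroup.of 0 * FreeGroup.of 1)⁻¹}

/-- Artin's braid group on three strands. -/
abbrev B3 : Type := PresentedGroup braidRels

/-- The first standard generator of `B₃`. -/
def s1 : B3 := PresentedGroup.of 0

/-- The second standard generator of `B₃`. -/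
def s2 : B3 := PresentedGroup.of 1

/-- The element `ζ = (σ₁σ₂)³`, which generates the center of `B₃`. -/
def zeta : B3 := (s1 * s2) ^ 3

/-- The matrices `(1 1; 0 1)` and `(1 0; -1 1)`. -/
def slGen : Fin 2 → SL(2, ℤ) :=
  ![⟨!![1, 1; 0, 1], by simp [Matrix.det_fin_two]⟩,
    ⟨!![1, 0; -1, 1], by simp [Matrix.det_fin_two]⟩]

theorem slGen_rel : ∀ r ∈ braidRels, FreeGroup.lift slGen r = 1 := by
  intro r hr
  rw [braidRels, Set.mem_singleton_iff] at hr
  subst hr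
  simp only [map_mul, map_inv, FreeGroup.lift_apply_of]
  rw [mul_inv_eq_one]
  decide

/-- The homomorphism `B₃ → SL(2, ℤ)` with `σ₁ ↦ (1 1; 0 1)` and `σ₂ ↦ (1 0; -1 1)`. -/
def toSL : B3 →* SL(2, ℤ) := PresentedGroup.toGroup slGen_rel

/-- The composition of `toSL` with the projection `SL(2, ℤ) → PSL(2, ℤ)`. -/
def toPSL : B3 →* PSL(2, ℤ) :=
  (QuotientGroup.mk' (Subgroup.center SL(2, ℤ))).comp toSL

/-- The representation of `G` obtained from a representation of `H` by restriction along a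
homomorphism `G → H`. -/
def pullback {K G H V : Type*} [Field K] [Group G] [Group H] [AddCommGroup V] [Module K V]
    (f : G →* H) (τ : Representation K H V) : Representation K G V :=
  MonoidHom.comp τ f

/-- `ζ` acts on the `B₃`-module as multiplication by the scalar `δ`. -/
def HasCentralScalar {K V : Type*} [Field K] [AddCommGroup V] [Module K V]
    (ρ : Representation K B3 V) (δ : K) : Prop :=
  ρ zeta = δ • LinearMap.id

end B3Rep

/-!
The half twist `σ₁σ₂σ₁` and the rotation `σ₁σ₂` generate `B₃`; the square of the former and the
cube of the latter are both `ζ`, which is therefore central.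

Every braid is, up to a power of `ζ`, of the form `rot ^ r * w * halfTwist ^ s` with `r < 3`,
`s < 2` and `w` a product of `σ₁⁻¹` and `σ₂`. The matrices of these `w` have nonnegative entries
up to a checkerboard of signs, so that of `rot ^ r * w * halfTwist ^ s` is scalar only if `r = 0`,
`s = 0` and `w = 1`. So `B₃ → PSL(2, ℤ)` and `B₃ → SL(2, ℤ)` have kernels `⟨ζ⟩` and `⟨ζ²⟩`, and
restriction identifies the modules of the target with those on which the kernel acts trivially.

In dimension two (three), `halfTwist` (`rot`) satisfies `X ^ 2 - δ` (`X ^ 3 - δ`). If this is its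
characteristic polynomial, then `δ` can be read off from the determinant. Otherwise its minimal
polynomial has smaller degree, so it has an eigenspace too large not to meet an eigenspace of a
second generator of `B₃`, and a common eigenvector of two generators spans a submodule.
-/

namespace B3Rep

section Pullback

variable {K G H V W : Type*} [Field K] [Group G] [Group H] [AddCommGroup V] [Module K V]
  [AddCommGroup W] [Module K W] {f : G →* H}

@[simp]
theorem pullback_apply (f : G →* H) (τ : Representation K H V) (g : G) :
    pullback f τ g = τ (f g) := rfl

/-- Along a surjective homomorphism, the subrepresentations of a restriction are those of the
original representation. -/
def subrepresentationPullback (hf : Function.Surjective f) (τ : Representation K H V) :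
    Subrepresentation (pullback f τ) ≃o Subrepresentation τ where
  toFun S := ⟨S.toSubmodule, hf.forall.2 fun g _ hv => S.apply_mem_toSubmodule g hv⟩
  invFun S := ⟨S.toSubmodule, fun g _ hv => S.apply_mem_toSubmodule (f g) hv⟩
  left_inv _ := rfl
  right_inv _ := rfl
  map_rel_iff' := Iff.rfl

theorem isIrreducible_pullback_iff (hf : Function.Surjective f) (τ : Representation K H V) :
    (pullback f τ).IsIrreducible ↔ τ.IsIrreducible :=
  (subrepresentationPullback hf τ).isSimpleOrder_iff

theorem pullback_injective (hf : Function.Surjective f) :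
    Function.Injective (pullback f : Representation K H V → Representation K G V) :=
  fun _ _ h => (MonoidHom.cancel_right hf).1 h

theorem exists_pullback_eq (hf : Function.Surjective f) {ρ : Representation K G V}
    (h : f.ker ≤ MonoidHom.ker ρ) : ∃ τ : Representation K H V, pullback f τ = ρ := by
  have hker : f.ker ≤ ρ.toHomUnits.ker := fun g hg => Units.ext (h hg)
  refine ⟨(Units.coeHom _).comp (f.liftOfSurjective hf ⟨ρ.toHomUnits, hker⟩), ?_⟩
  ext1 g
  exact congrArg Units.val
    (f.liftOfRightInverse_comp_apply _ (Function.rightInverse_surjInv hf) ⟨ρ.toHomUnits, hker⟩ g)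

theorem bijOn_pullback (hf : Function.Surjective f) :
    Set.BijOn (pullback f) {τ : Representation K H V | τ.IsIrreducible}
      {ρ : Representation K G V | ρ.IsIrreducible ∧ f.ker ≤ MonoidHom.ker ρ} := by
  refine ⟨fun τ hτ => ⟨(isIrreducible_pullback_iff hf τ).2 hτ, fun g hg => ?_⟩,
    (pullback_injective hf).injOn, fun ρ ⟨hρ, hker⟩ => ?_⟩
  · rw [MonoidHom.mem_ker, pullback_apply, hg, map_one]
  · obtain ⟨τ, rfl⟩ := exists_pullback_eq hf hker
    exact ⟨τ, (isIrreducible_pullback_iff hf τ).1 hρ, rfl⟩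

theorem nonempty_equiv_pullback_iff (hf : Function.Surjective f) (τ : Representation K H V)
    (τ' : Representation K H W) :
    Nonempty (τ.Equiv τ') ↔ Nonempty ((pullback f τ).Equiv (pullback f τ')) :=
  ⟨fun ⟨e⟩ => ⟨.mk e.toLinearEquiv fun g => e.isIntertwining' (f g)⟩,
    fun ⟨e⟩ => ⟨.mk e.toLinearEquiv (hf.forall.2 e.isIntertwining')⟩⟩

end Pullback

section Irreducible

open Module

variable {K G V : Type*} [Field K] [Group G] [AddCommGroup V] [Module K V]
  (ρ : Representation K G V)

theorem nontrivial_of_isIrreducible [ρ.IsIrreducible] : Nontrivial V :=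
  (Submodule.nontrivial_iff K).1
    (Subrepresentation.toSubmodule_injective (ρ := ρ)).nontrivial

variable {ρ} in
theorem eq_bot_or_eq_top_of_map_eq [ρ.IsIrreducible] {s : Set G} (hs : Subgroup.closure s = ⊤)
    {S : Submodule K V} (hS : ∀ g ∈ s, S.map (ρ g) = S) : S = ⊥ ∨ S = ⊤ := by
  have hmap (g : G) : S.map (ρ g) = S := by
    have hg : g ∈ Subgroup.closure s := hs ▸ Subgroup.mem_top g
    induction hg using Subgroup.closure_induction with
    | mem g hg => exact hS g hg
    | one => rw [map_one, Module.End.one_eq_id, Submodule.map_id]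
    | mul g h _ _ hg hh => rw [map_mul, Module.End.mul_eq_comp, Submodule.map_comp, hh, hg]
    | inv g _ hg =>
      nth_rw 1 [← hg]
      rw [← Submodule.map_comp, ← Module.End.mul_eq_comp, ← map_mul, inv_mul_cancel, map_one,
        Module.End.one_eq_id, Submodule.map_id]
  let T : Subrepresentation ρ :=
    ⟨S, fun g v hv => (hmap g).le (Submodule.mem_map_of_mem hv)⟩
  exact (eq_bot_or_eq_top T).imp (congrArg Subrepresentation.toSubmodule)
    (congrArg Subrepresentation.toSubmodule)

variable {ρ} in
theorem finrank_eq_one_of_common_eigenvector [ρ.IsIrreducible] {s : Set G}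
    (hs : Subgroup.closure s = ⊤) {v : V} (hv : v ≠ 0)
    (h : ∀ g ∈ s, ∃ c : K, ρ g v = c • v) : finrank K V = 1 := by
  have hline : K ∙ v = ⊤ := by
    refine (eq_bot_or_eq_top_of_map_eq (ρ := ρ) hs fun g hg => ?_).resolve_left
      (mt Submodule.span_singleton_eq_bot.1 hv)
    obtain ⟨c, hc⟩ := h g hg
    have hc0 : c ≠ 0 := by
      rintro rfl
      exact hv ((ρ.apply_bijective g).1 (by rw [hc, zero_smul, map_zero]))
    rw [Submodule.map_span, Set.image_singleton, hc,
      Submodule.span_singleton_smul_eq hc0.isUnit]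
  rw [← finrank_top, ← hline, finrank_span_singleton hv]

theorem disjoint_eigenspace_of_closure_eq_top [ρ.IsIrreducible] {g h : G}
    (hgh : Subgroup.closure {g, h} = ⊤) (hV : finrank K V ≠ 1) (c d : K) :
    Disjoint (End.eigenspace (ρ g) c) (End.eigenspace (ρ h) d) := by
  refine Submodule.disjoint_def.2 fun v hc hd => by_contra fun hv => hV ?_
  refine finrank_eq_one_of_common_eigenvector (ρ := ρ) hgh hv ?_
  rintro x (rfl | rfl)
  · exact ⟨c, End.mem_eigenspace_iff.1 hc⟩
  · exact ⟨d, End.mem_eigenspace_iff.1 hd⟩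

theorem exists_apply_eq_smul_id_of_mem_center [IsAlgClosed K] [FiniteDimensional K V]
    [ρ.IsIrreducible] {z : G} (hz : z ∈ Subgroup.center G) : ∃ c : K, ρ z = c • LinearMap.id := by
  obtain ⟨c, hc⟩ :=
    (Representation.IsIrreducible.algebraMap_intertwiningMap_bijective_of_isAlgClosed
      (ρ := ρ)).2 (.centralMul ρ z hz)
  exact ⟨c, (congrArg Representation.IntertwiningMap.toLinearMap hc).symm⟩

theorem apply_eq_one_or_neg_one_of_mem_center [ρ.IsIrreducible] {z : G}
    (hz : z ∈ Subgroup.center G) (h : ρ z ^ 2 = 1) : ρ z = 1 ∨ ρ z = -1 := by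
  let φ : Representation.IntertwiningMap ρ ρ := .centralMul ρ z hz - .id ρ
  have hφ (v : V) : φ v = ρ z v - v := rfl
  rcases Representation.IsIrreducible.injective_or_eq_zero φ with hinj | hzero
  · refine .inr (LinearMap.ext fun v => eq_neg_of_add_eq_zero_left (hinj ?_))
    rw [map_zero, hφ, map_add, ← Module.End.mul_apply, ← pow_two, h, Module.End.one_apply,
      add_comm, sub_self]
  · exact .inl (LinearMap.ext fun v => sub_eq_zero.1 ((hφ v).symm.trans (by rw [hzero]; rfl)))

end Irreducible

section MinimalPolynomial

open Module Polynomial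

variable {K V : Type*} [Field K] [AddCommGroup V] [Module K V] {f : End K V} {c : K}

theorem natDegree_minpoly_le_of_pow_eq_smul_id {n : ℕ} (hn : n ≠ 0)
    (hf : f ^ n = c • LinearMap.id) : (minpoly K f).natDegree ≤ n := by
  have hroot : aeval f (X ^ n - C c) = 0 := by
    rw [map_sub, map_pow, aeval_X, aeval_C, hf]
    exact sub_self _
  rw [← natDegree_X_pow_sub_C (n := n) (r := c)]
  exact natDegree_le_of_dvd (minpoly.dvd K f hroot) (X_pow_sub_C_ne_zero (Nat.pos_of_ne_zero hn) c)

variable [FiniteDimensional K V]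

theorem minpoly_monic (f : End K V) : (minpoly K f).Monic :=
  minpoly.monic (Algebra.IsIntegral.isIntegral f)

theorem det_eq_of_pow_finrank_eq_smul_id [Nontrivial V]
    (hf : f ^ finrank K V = c • LinearMap.id) (hmin : finrank K V ≤ (minpoly K f).natDegree) :
    LinearMap.det f = (-1) ^ finrank K V * -c := by
  have hn : finrank K V ≠ 0 := finrank_pos.ne'
  have hroot : aeval f (X ^ finrank K V - C c) = 0 := by
    rw [map_sub, map_pow, aeval_X, aeval_C, hf]
    exact sub_self _
  have hbinom : X ^ finrank K V - C c = minpoly K f :=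
    eq_of_monic_of_dvd_of_natDegree_le (minpoly_monic f) (monic_X_pow_sub_C c hn)
      (minpoly.dvd K f hroot) (by rwa [natDegree_X_pow_sub_C])
  have hchar : f.charpoly = minpoly K f :=
    eq_of_monic_of_dvd_of_natDegree_le (minpoly_monic f) f.charpoly_monic
      (LinearMap.minpoly_dvd_charpoly f) (by rwa [LinearMap.charpoly_natDegree])
  rw [LinearMap.det_eq_sign_charpoly_coeff, hchar, ← hbinom, coeff_sub, coeff_X_pow,
    if_neg hn.symm, coeff_C_zero, zero_sub]

theorem exists_hasEigenvalue_of_natDegree_minpoly_lt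
    (hmin : (minpoly K f).natDegree < finrank K V) (hV : finrank K V ≤ 3) :
    ∃ c, f.HasEigenvalue c := by
  have : Nontrivial V := nontrivial_of_finrank_pos (Nat.zero_lt_of_lt hmin)
  have hint : IsIntegral K f := Algebra.IsIntegral.isIntegral f
  have hpos : 0 < (minpoly K f).natDegree := minpoly.natDegree_pos hint
  have hreducible : ¬ Irreducible f.charpoly := fun hirr => by
    have hassoc := (hirr.dvd_iff.1 (LinearMap.minpoly_dvd_charpoly f)).resolve_left
      (minpoly.not_isUnit K f)
    have hdeg := natDegree_eq_of_degree_eq (degree_eq_degree_of_associated hassoc)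
    rw [LinearMap.charpoly_natDegree] at hdeg
    exact hmin.ne' hdeg
  rw [f.charpoly_monic.irreducible_iff_roots_eq_zero_of_degree_le_three
    (by rw [LinearMap.charpoly_natDegree]; lia) (by rwa [LinearMap.charpoly_natDegree])]
    at hreducible
  obtain ⟨c, hc⟩ := Multiset.exists_mem_of_ne_zero hreducible
  exact ⟨c, (End.hasEigenvalue_iff_isRoot_charpoly f c).2 (isRoot_of_mem_roots hc)⟩

theorem finrank_le_of_sub_smul_mul_sub_smul_eq_zero {a b : K}
    (h : (f - a • 1) * (f - b • 1) = 0) :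
    finrank K V ≤ finrank K (f.eigenspace a) + finrank K (f.eigenspace b) := by
  have hrange : LinearMap.range (f - b • 1) ≤ f.eigenspace a := by
    rw [End.eigenspace_def]
    exact LinearMap.range_le_ker_iff.2 h
  have hker : LinearMap.ker (f - b • 1) = f.eigenspace b := End.eigenspace_def.symm
  rw [← LinearMap.finrank_range_add_finrank_ker (f - b • 1), hker]
  exact Nat.add_le_add_right (Submodule.finrank_mono hrange) _

theorem exists_finrank_le_two_mul_finrank_eigenspace (hmin : (minpoly K f).natDegree ≤ 2)
    (hc : f.HasEigenvalue c) : ∃ d, finrank K V ≤ 2 * finrank K (f.eigenspace d) := by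
  suffices ∃ d, finrank K V ≤ finrank K (f.eigenspace c) + finrank K (f.eigenspace d) by
    obtain ⟨d, hd⟩ := this
    rcases le_total (finrank K (f.eigenspace c)) (finrank K (f.eigenspace d)) with hcd | hcd
    · exact ⟨d, by lia⟩
    · exact ⟨c, by lia⟩
  obtain ⟨r, hr⟩ := dvd_iff_isRoot.2 (End.isRoot_of_hasEigenvalue hc)
  have hmonic : r.Monic := (monic_X_sub_C c).of_mul_monic_left (hr ▸ minpoly_monic f)
  have hdeg : r.natDegree ≤ 1 := by
    rw [hr, (monic_X_sub_C c).natDegree_mul hmonic, natDegree_X_sub_C] at hmin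
    lia
  have hroot := minpoly.aeval K f
  rw [hr, map_mul, map_sub, aeval_X, aeval_C, Algebra.algebraMap_eq_smul_one] at hroot
  rcases Nat.le_one_iff_eq_zero_or_eq_one.1 hdeg with hdeg | hdeg
  · rw [hmonic.natDegree_eq_zero.1 hdeg, map_one, mul_one] at hroot
    exact ⟨c, finrank_le_of_sub_smul_mul_sub_smul_eq_zero (by rw [hroot, zero_mul])⟩
  · refine ⟨-r.coeff 0, finrank_le_of_sub_smul_mul_sub_smul_eq_zero ?_⟩
    rwa [hmonic.eq_X_add_C hdeg, map_add, aeval_X, aeval_C, Algebra.algebraMap_eq_smul_one,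
      ← sub_neg_eq_add, ← neg_smul] at hroot

end MinimalPolynomial

section BraidGroup

/-- The half twist `σ₁σ₂σ₁`, a square root of `zeta`. -/
def halfTwist : B3 := s1 * s2 * s1

/-- The element `σ₁σ₂`, a cube root of `zeta`; as a braid on a cylinder it rotates the strands. -/
def rot : B3 := s1 * s2

theorem rot_mul_s1 : rot * s1 = halfTwist := rfl

theorem s2_mul_rot : s2 * rot = halfTwist := by
  have braid_rel := PresentedGroup.one_of_mem (rels := braidRels) (Set.mem_singleton _)
  rw [map_mul, map_inv, mul_inv_eq_one] at braid_rel
  exact (mul_assoc s2 s1 s2).symm.trans braid_rel.symm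

theorem rot_pow_three : rot ^ 3 = zeta := rfl

theorem halfTwist_sq : halfTwist ^ 2 = zeta := by
  rw [pow_two]
  nth_rw 2 [← s2_mul_rot]
  rw [← rot_mul_s1, mul_assoc, ← mul_assoc s1, ← rot_pow_three, pow_three]
  rfl

theorem halfTwist_mul_s1 : halfTwist * s1 = s2 * halfTwist := by
  rw [← rot_mul_s1, ← mul_assoc, s2_mul_rot, rot_mul_s1]

theorem isConj_s1_s2 : IsConj s1 s2 :=
  isConj_iff.2 ⟨halfTwist, by rw [halfTwist_mul_s1, mul_inv_cancel_right]⟩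

theorem closure_s1_s2 : Subgroup.closure {s1, s2} = ⊤ := by
  have hrange : Set.range (PresentedGroup.of (rels := braidRels)) = {s1, s2} :=
    Set.ext fun _ => Fin.exists_fin_two.trans (or_congr eq_comm eq_comm)
  rw [← hrange, PresentedGroup.closure_range_of]

theorem closure_halfTwist_s1 : Subgroup.closure {halfTwist, s1} = ⊤ := by
  have h1 : s1 ∈ Subgroup.closure {halfTwist, s1} := Subgroup.mem_closure_of_mem (.inr rfl)
  have hh : halfTwist ∈ Subgroup.closure {halfTwist, s1} := Subgroup.mem_closure_of_mem (.inl rfl)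
  rw [eq_top_iff, ← closure_s1_s2, Subgroup.closure_le]
  rintro x (rfl | rfl)
  · exact h1
  · rw [eq_mul_inv_of_mul_eq halfTwist_mul_s1.symm]
    exact mul_mem (mul_mem hh h1) (inv_mem hh)

theorem closure_halfTwist_rot : Subgroup.closure {halfTwist, rot} = ⊤ := by
  have hr : rot ∈ Subgroup.closure {halfTwist, rot} := Subgroup.mem_closure_of_mem (.inr rfl)
  have hh : halfTwist ∈ Subgroup.closure {halfTwist, rot} := Subgroup.mem_closure_of_mem (.inl rfl)
  rw [eq_top_iff, ← closure_halfTwist_s1, Subgroup.closure_le]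
  rintro x (rfl | rfl)
  · exact hh
  · rw [eq_inv_mul_of_mul_eq rot_mul_s1]
    exact mul_mem (inv_mem hr) hh

theorem zeta_mem_center : zeta ∈ Subgroup.center B3 := by
  rw [← Subgroup.centralizer_univ, ← Subgroup.coe_top, ← closure_halfTwist_rot,
    Subgroup.centralizer_closure]
  rintro x (rfl | rfl)
  · exact (halfTwist_sq ▸ Commute.self_pow halfTwist 2 :)
  · exact (rot_pow_three ▸ Commute.self_pow rot 3 :)

/-- The braids that are products of the generators `σ₁⁻¹` and `σ₂`; their diagrams alternate. -/
def alternatingBraids : Submonoid B3 := Submonoid.closure {s1⁻¹, s2}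

theorem s1_inv_mem_alternatingBraids : s1⁻¹ ∈ alternatingBraids :=
  Submonoid.mem_closure_of_mem (.inl rfl)

theorem s2_mem_alternatingBraids : s2 ∈ alternatingBraids :=
  Submonoid.mem_closure_of_mem (.inr rfl)

theorem alternatingBraids_cases {w : B3} (hw : w ∈ alternatingBraids) :
    w = 1 ∨ ∃ w' ∈ alternatingBraids, w = s1⁻¹ * w' ∨ w = s2 * w' := by
  induction hw using Submonoid.closure_induction_left with
  | one => exact .inl rfl
  | mul_left x hx w' hw' _ => exact .inr ⟨w', hw', hx.imp (congrArg (· * w')) (congrArg (· * w'))⟩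

theorem halfTwist_mul_s2 : halfTwist * s2 = rot ^ 2 :=
  (mul_assoc rot s1 s2).trans (pow_two rot).symm

theorem halfTwist_mul_rot : halfTwist * rot = zeta * s1⁻¹ := by
  rw [eq_mul_inv_iff_mul_eq, mul_assoc, rot_mul_s1, ← pow_two, halfTwist_sq]

theorem halfTwist_mul_rot_sq : halfTwist * rot ^ 2 = zeta * s2 := by
  rw [← halfTwist_mul_s2, ← mul_assoc, ← pow_two, halfTwist_sq]

theorem rot_zpow_three_mul_add (q : ℤ) (r : ℕ) : rot ^ (3 * q + r) = zeta ^ q * rot ^ r := by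
  rw [zpow_add, zpow_mul, zpow_natCast, zpow_ofNat, rot_pow_three]

theorem halfTwist_zpow_two_mul_add (q : ℤ) (r : ℕ) :
    halfTwist ^ (2 * q + r) = zeta ^ q * halfTwist ^ r := by
  rw [zpow_add, zpow_mul, zpow_natCast, zpow_ofNat, halfTwist_sq]

theorem mul_zeta_zpow_comm (x : B3) (k : ℤ) : x * zeta ^ k = zeta ^ k * x :=
  Subgroup.mem_center_iff.1 (zpow_mem zeta_mem_center k) x

theorem exists_halfTwist_mul_rot_pow_mul_eq {w : B3} (hw : w ∈ alternatingBraids) {r : ℕ}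
    (hr : r < 3) : ∃ (i j : ℤ), ∃ w' ∈ alternatingBraids,
      halfTwist * rot ^ r * w = rot ^ i * w' * halfTwist ^ j := by
  interval_cases r
  · obtain rfl | ⟨w', hw', rfl | rfl⟩ := alternatingBraids_cases hw
    · exact ⟨0, 1, 1, one_mem _, by group⟩
    · exact ⟨1, 0, w', hw', by rw [← rot_mul_s1]; group⟩
    · exact ⟨2, 0, w', hw', by rw [pow_zero, mul_one, ← mul_assoc, halfTwist_mul_s2]; group⟩
  · refine ⟨3, 0, s1⁻¹ * w, mul_mem s1_inv_mem_alternatingBraids hw, ?_⟩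
    rw [pow_one, halfTwist_mul_rot, ← rot_pow_three]; group
  · refine ⟨3, 0, s2 * w, mul_mem s2_mem_alternatingBraids hw, ?_⟩
    rw [halfTwist_mul_rot_sq, ← rot_pow_three]; group

theorem exists_halfTwist_mul_rot_zpow_mul_eq {w : B3} (hw : w ∈ alternatingBraids) (i : ℤ) :
    ∃ (i' j : ℤ), ∃ w' ∈ alternatingBraids,
      halfTwist * rot ^ i * w = rot ^ i' * w' * halfTwist ^ j := by
  obtain ⟨q, r, hr, rfl⟩ : ∃ (q : ℤ) (r : ℕ), r < 3 ∧ i = 3 * q + r :=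
    ⟨i / 3, (i % 3).toNat, by lia, by lia⟩
  obtain ⟨i', j, w', hw', h⟩ := exists_halfTwist_mul_rot_pow_mul_eq hw hr
  refine ⟨3 * q + i', j, w', hw', ?_⟩
  rw [rot_zpow_three_mul_add, ← mul_assoc, mul_zeta_zpow_comm, mul_assoc, mul_assoc,
    ← mul_assoc halfTwist, h, ← rot_pow_three]
  group

theorem exists_eq_rot_zpow_mul_mul_halfTwist_zpow (x : B3) :
    ∃ (i j : ℤ), ∃ w ∈ alternatingBraids, x = rot ^ i * w * halfTwist ^ j := by
  have hx : x ∈ Subgroup.closure {halfTwist, rot} := closure_halfTwist_rot ▸ Subgroup.mem_top x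
  induction hx using Subgroup.closure_induction_left with
  | one => exact ⟨0, 0, 1, one_mem _, by group⟩
  | mul_left y hy x _ hx =>
    obtain ⟨i, j, w, hw, rfl⟩ := hx
    obtain rfl | rfl := hy
    · obtain ⟨i', j', w', hw', h⟩ := exists_halfTwist_mul_rot_zpow_mul_eq hw i
      exact ⟨i', j' + j, w', hw', by rw [← mul_assoc, ← mul_assoc, h]; group⟩
    · exact ⟨1 + i, j, w, hw, by group⟩
  | inv_mul_cancel y hy x _ hx =>
    obtain ⟨i, j, w, hw, rfl⟩ := hx
    obtain rfl | rfl := hy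
    · obtain ⟨i', j', w', hw', h⟩ := exists_halfTwist_mul_rot_zpow_mul_eq hw i
      refine ⟨-3 + i', j' + j, w', hw', ?_⟩
      have hinv : halfTwist⁻¹ = rot ^ (-3 : ℤ) * halfTwist := by
        rw [zpow_neg, zpow_ofNat, rot_pow_three, ← halfTwist_sq]; group
      rw [hinv, mul_assoc, ← mul_assoc halfTwist, ← mul_assoc halfTwist, h]
      group
    · exact ⟨-1 + i, j, w, hw, by group⟩

theorem exists_eq_zeta_zpow_mul_rot_pow_mul_mul_halfTwist_pow (x : B3) :
    ∃ k : ℤ, ∃ r < 3, ∃ s < 2, ∃ w ∈ alternatingBraids,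
      x = zeta ^ k * (rot ^ r * w * halfTwist ^ s) := by
  obtain ⟨i, j, w, hw, rfl⟩ := exists_eq_rot_zpow_mul_mul_halfTwist_zpow x
  obtain ⟨q, r, hr, rfl⟩ : ∃ (q : ℤ) (r : ℕ), r < 3 ∧ i = 3 * q + r :=
    ⟨i / 3, (i % 3).toNat, by lia, by lia⟩
  obtain ⟨m, s, hs, rfl⟩ : ∃ (m : ℤ) (s : ℕ), s < 2 ∧ j = 2 * m + s :=
    ⟨j / 2, (j % 2).toNat, by lia, by lia⟩
  refine ⟨q + m, r, hr, s, hs, w, hw, ?_⟩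
  rw [rot_zpow_three_mul_add, halfTwist_zpow_two_mul_add, ← mul_assoc _ (zeta ^ m),
    mul_zeta_zpow_comm]
  group

end BraidGroup

section ModularGroup

theorem toSL_s1 : toSL s1 = slGen 0 := PresentedGroup.toGroup.of slGen_rel

theorem toSL_s2 : toSL s2 = slGen 1 := PresentedGroup.toGroup.of slGen_rel

theorem coe_toSL_s1_inv : (toSL s1⁻¹ : Matrix (Fin 2) (Fin 2) ℤ) = !![1, -1; 0, 1] := by
  rw [map_inv, toSL_s1]; decide

theorem coe_toSL_s2 : (toSL s2 : Matrix (Fin 2) (Fin 2) ℤ) = !![1, 0; -1, 1] := by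
  rw [toSL_s2]; decide

theorem coe_toSL_rot : (toSL rot : Matrix (Fin 2) (Fin 2) ℤ) = !![0, 1; -1, 1] := by
  rw [rot, map_mul, toSL_s1, toSL_s2]; decide

theorem coe_toSL_halfTwist : (toSL halfTwist : Matrix (Fin 2) (Fin 2) ℤ) = !![0, 1; -1, 0] := by
  rw [halfTwist, map_mul, map_mul, toSL_s1, toSL_s2]; decide

theorem toSL_s1_inv_mul_zero (x : B3) (j : Fin 2) :
    toSL (s1⁻¹ * x) 0 j = toSL x 0 j - toSL x 1 j := by
  rw [map_mul, Matrix.SpecialLinearGroup.coe_mul, coe_toSL_s1_inv, Matrix.mul_apply]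
  simp [sub_eq_add_neg]

theorem toSL_s2_mul_one (x : B3) (j : Fin 2) :
    toSL (s2 * x) 1 j = toSL x 1 j - toSL x 0 j := by
  rw [map_mul, Matrix.SpecialLinearGroup.coe_mul, coe_toSL_s2, Matrix.mul_apply]
  simp [neg_add_eq_sub]

theorem toSL_rot_mul_zero (x : B3) (j : Fin 2) : toSL (rot * x) 0 j = toSL x 1 j := by
  rw [map_mul, Matrix.SpecialLinearGroup.coe_mul, coe_toSL_rot, Matrix.mul_apply]
  simp

theorem toSL_rot_mul_one (x : B3) (j : Fin 2) :
    toSL (rot * x) 1 j = toSL x 1 j - toSL x 0 j := by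
  rw [map_mul, Matrix.SpecialLinearGroup.coe_mul, coe_toSL_rot, Matrix.mul_apply]
  simp [neg_add_eq_sub]

theorem toSL_mul_halfTwist_zero (x : B3) (i : Fin 2) :
    toSL (x * halfTwist) i 0 = -toSL x i 1 := by
  rw [map_mul, Matrix.SpecialLinearGroup.coe_mul, coe_toSL_halfTwist, Matrix.mul_apply]
  simp

theorem toSL_mul_halfTwist_one (x : B3) (i : Fin 2) :
    toSL (x * halfTwist) i 1 = toSL x i 0 := by
  rw [map_mul, Matrix.SpecialLinearGroup.coe_mul, coe_toSL_halfTwist, Matrix.mul_apply]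
  simp

theorem toSL_zeta : toSL zeta = -1 := by
  rw [zeta, map_pow, map_mul, toSL_s1, toSL_s2]; decide

theorem toSL_surjective : Function.Surjective toSL := by
  rw [← MonoidHom.range_eq_top, eq_top_iff, ← SpecialLinearGroup.SL2Z_generators,
    Subgroup.closure_le]
  rintro x (rfl | rfl)
  · exact ⟨halfTwist⁻¹, by
      rw [map_inv, halfTwist, map_mul, map_mul, toSL_s1, toSL_s2]; decide⟩
  · exact ⟨s1, by rw [toSL_s1]; decide⟩

theorem toPSL_surjective : Function.Surjective toPSL :=
  (QuotientGroup.mk'_surjective _).comp toSL_surjective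

/-- The submonoid of `SL(2, ℤ)` of the matrices with sign pattern `(+ -; - +)`, where the
off-diagonal entries may vanish. -/
def checkerboard : Submonoid SL(2, ℤ) where
  carrier := {A | 0 < A 0 0 ∧ A 0 1 ≤ 0 ∧ A 1 0 ≤ 0 ∧ 0 < A 1 1}
  one_mem' := by simp
  mul_mem' := by
    rintro A B ⟨a, b, c, d⟩ ⟨a', b', c', d'⟩
    simp only [Set.mem_ofPred_eq, Matrix.SpecialLinearGroup.coe_mul, Matrix.mul_apply,
      Fin.sum_univ_two]
    exact ⟨by nlinarith, by nlinarith, by nlinarith, by nlinarith⟩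

theorem alternatingBraids_le_comap_checkerboard :
    alternatingBraids ≤ checkerboard.comap toSL := by
  rw [alternatingBraids, Submonoid.closure_le]
  rintro x (rfl | rfl)
  · change 0 < toSL s1⁻¹ 0 0 ∧ toSL s1⁻¹ 0 1 ≤ 0 ∧ toSL s1⁻¹ 1 0 ≤ 0 ∧ 0 < toSL s1⁻¹ 1 1
    rw [coe_toSL_s1_inv]; decide
  · change 0 < toSL s2 0 0 ∧ toSL s2 0 1 ≤ 0 ∧ toSL s2 1 0 ≤ 0 ∧ 0 < toSL s2 1 1
    rw [coe_toSL_s2]; decide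

theorem eq_one_of_mem_alternatingBraids {w : B3} (hw : w ∈ alternatingBraids)
    (h01 : toSL w 0 1 = 0) (h10 : toSL w 1 0 = 0) : w = 1 := by
  obtain rfl | ⟨w', hw', rfl | rfl⟩ := alternatingBraids_cases hw
  · rfl
  · obtain ⟨-, h, -, h'⟩ := alternatingBraids_le_comap_checkerboard hw'
    rw [toSL_s1_inv_mul_zero] at h01
    lia
  · obtain ⟨h, -, h', -⟩ := alternatingBraids_le_comap_checkerboard hw'
    rw [toSL_s2_mul_one] at h10
    lia

theorem mem_ker_toPSL_iff {x : B3} : x ∈ toPSL.ker ↔ toSL x ∈ Subgroup.center SL(2, ℤ) :=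
  QuotientGroup.eq_one_iff _

theorem zeta_mem_ker_toPSL : zeta ∈ toPSL.ker := by
  rw [mem_ker_toPSL_iff, toSL_zeta, Matrix.SpecialLinearGroup.mem_center_iff]
  exact ⟨-1, by simp, by simp⟩

theorem toSL_apply_eq_zero_of_mem_ker_toPSL {x : B3} (hx : x ∈ toPSL.ker) :
    toSL x 0 1 = 0 ∧ toSL x 1 0 = 0 := by
  obtain ⟨c, -, hc⟩ := Matrix.SpecialLinearGroup.mem_center_iff.1 (mem_ker_toPSL_iff.1 hx)
  rw [← hc]
  exact ⟨rfl, rfl⟩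

theorem eq_one_of_mem_ker_toPSL {r s : ℕ} (hr : r < 3) (hs : s < 2) {w : B3}
    (hw : w ∈ alternatingBraids) (h : rot ^ r * w * halfTwist ^ s ∈ toPSL.ker) :
    rot ^ r * w * halfTwist ^ s = 1 := by
  obtain ⟨h01, h10⟩ := toSL_apply_eq_zero_of_mem_ker_toPSL h
  obtain ⟨h₁, h₂, h₃, h₄⟩ := alternatingBraids_le_comap_checkerboard hw
  suffices r = 0 ∧ s = 0 by
    obtain ⟨rfl, rfl⟩ := this
    rw [pow_zero, pow_zero, one_mul, mul_one] at h01 h10 ⊢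
    exact eq_one_of_mem_alternatingBraids hw h01 h10
  interval_cases r <;> interval_cases s <;>
    simp only [pow_zero, pow_one, pow_two, one_mul, mul_one, mul_assoc, toSL_rot_mul_zero,
      toSL_rot_mul_one, toSL_mul_halfTwist_zero, toSL_mul_halfTwist_one] at h01 h10 <;>
    lia

theorem ker_toPSL : toPSL.ker = Subgroup.zpowers zeta := by
  refine le_antisymm (fun x hx => ?_) ((Subgroup.zpowers_le).2 zeta_mem_ker_toPSL)
  obtain ⟨k, r, hr, s, hs, w, hw, rfl⟩ :=
    exists_eq_zeta_zpow_mul_rot_pow_mul_mul_halfTwist_pow x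
  rw [Subgroup.mul_mem_cancel_left _ (zpow_mem zeta_mem_ker_toPSL k)] at hx
  rw [eq_one_of_mem_ker_toPSL hr hs hw hx, mul_one]
  exact Subgroup.zpow_mem_zpowers zeta k

theorem ker_toSL : toSL.ker = Subgroup.zpowers (zeta ^ 2) := by
  refine le_antisymm (fun x hx => ?_) (Subgroup.zpowers_le.2 ?_)
  · have hx' : x ∈ toPSL.ker := mem_ker_toPSL_iff.2 (hx ▸ one_mem _)
    obtain ⟨k, rfl⟩ := Subgroup.mem_zpowers_iff.1 (ker_toPSL ▸ hx')
    rw [MonoidHom.mem_ker, map_zpow, toSL_zeta] at hx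
    obtain ⟨m, rfl⟩ | hodd := Int.even_or_odd k
    · exact ⟨m, by rw [← two_mul, zpow_mul]; rfl⟩
    · rw [hodd.neg_one_zpow] at hx
      exact absurd hx (by decide)
  · rw [MonoidHom.mem_ker, map_pow, toSL_zeta, neg_one_sq]

end ModularGroup

section CentralScalar

open Module

variable {K V : Type*} [Field K] [AddCommGroup V] [Module K V] {ρ : Representation K B3 V}
  {δ ε μ : K}

theorem det_s2 (ρ : Representation K B3 V) : LinearMap.det (ρ s2) = LinearMap.det (ρ s1) :=
  (isConj_iff_eq.1 ((LinearMap.det.comp ρ).map_isConj isConj_s1_s2)).symm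

theorem det_rot (ρ : Representation K B3 V) :
    LinearMap.det (ρ rot) = LinearMap.det (ρ s1) ^ 2 := by
  rw [rot, map_mul, map_mul, det_s2, pow_two]

theorem det_halfTwist (ρ : Representation K B3 V) :
    LinearMap.det (ρ halfTwist) = LinearMap.det (ρ s1) ^ 3 := by
  rw [← rot_mul_s1, map_mul, map_mul, det_rot, ← pow_succ]

theorem HasCentralScalar.rot_pow_three (h : HasCentralScalar ρ δ) :
    ρ rot ^ 3 = δ • LinearMap.id := by
  rw [← map_pow, B3Rep.rot_pow_three, h]

theorem HasCentralScalar.halfTwist_sq (h : HasCentralScalar ρ δ) :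
    ρ halfTwist ^ 2 = δ • LinearMap.id := by
  rw [← map_pow, B3Rep.halfTwist_sq, h]

theorem HasCentralScalar.unique [Nontrivial V] (hδ : HasCentralScalar ρ δ)
    (hε : HasCentralScalar ρ ε) : δ = ε :=
  smul_left_injective K (one_ne_zero : (1 : End K V) ≠ 0) (hδ.symm.trans hε)

theorem HasCentralScalar.pow_finrank (h : HasCentralScalar ρ δ) :
    δ ^ finrank K V = LinearMap.det (ρ s1) ^ 6 := by
  rw [pow_mul _ 2 3, ← det_rot, ← map_pow, h.rot_pow_three, LinearMap.det_smul, LinearMap.det_id,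
    mul_one]

theorem existsUnique_hasCentralScalar [IsAlgClosed K] [FiniteDimensional K V]
    (ρ : Representation K B3 V) [ρ.IsIrreducible] : ∃! δ : K, HasCentralScalar ρ δ := by
  have := nontrivial_of_isIrreducible ρ
  obtain ⟨δ, hδ⟩ := exists_apply_eq_smul_id_of_mem_center ρ zeta_mem_center
  exact ⟨δ, hδ, fun ε hε => HasCentralScalar.unique hε hδ⟩

theorem apply_zeta_eq_one_iff : ρ zeta = 1 ↔ ∃ δ : K, HasCentralScalar ρ δ ∧ δ = 1 := by
  rw [exists_eq_right, HasCentralScalar, one_smul, End.one_eq_id]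

theorem apply_zeta_sq_eq_one_iff [ρ.IsIrreducible] :
    ρ (zeta ^ 2) = 1 ↔ ∃ δ : K, HasCentralScalar ρ δ ∧ δ ^ 2 = 1 := by
  rw [map_pow]
  refine ⟨fun h => ?_, fun ⟨δ, hδ, h⟩ => ?_⟩
  · rcases apply_eq_one_or_neg_one_of_mem_center ρ zeta_mem_center h with hζ | hζ
    · exact ⟨1, hζ.trans (one_smul K _).symm, one_pow 2⟩
    · exact ⟨-1, hζ.trans (neg_one_smul K _).symm, neg_one_sq⟩
  · rw [hδ, smul_pow, h, one_smul, ← End.one_eq_id, one_pow]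

theorem bijOn_pullback_toSL :
    Set.BijOn (pullback toSL) {τ : Representation K SL(2, ℤ) V | τ.IsIrreducible}
      {ρ : Representation K B3 V | ρ.IsIrreducible ∧
        ∃ δ : K, HasCentralScalar ρ δ ∧ δ ^ 2 = 1} := by
  convert bijOn_pullback (K := K) (V := V) toSL_surjective using 3 with ρ
  rw [ker_toSL, Subgroup.zpowers_le]
  exact and_congr_right fun _ => apply_zeta_sq_eq_one_iff.symm

theorem bijOn_pullback_toPSL :
    Set.BijOn (pullback toPSL) {τ : Representation K PSL(2, ℤ) V | τ.IsIrreducible}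
      {ρ : Representation K B3 V | ρ.IsIrreducible ∧
        ∃ δ : K, HasCentralScalar ρ δ ∧ δ = 1} := by
  convert bijOn_pullback (K := K) (V := V) toPSL_surjective using 3 with ρ
  rw [ker_toPSL, Subgroup.zpowers_le]
  exact and_congr_right fun _ => apply_zeta_eq_one_iff.symm

theorem HasCentralScalar.eq_of_finrank_eq_two [ρ.IsIrreducible] (h : HasCentralScalar ρ δ)
    (hμ : End.HasEigenvalue (ρ s1) μ) (hd : finrank K V = 2) :
    δ = -LinearMap.det (ρ s1) ^ 3 := by
  have := nontrivial_of_isIrreducible ρ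
  have : FiniteDimensional K V := .of_finrank_pos (by lia)
  have hmin : finrank K V ≤ (minpoly K (ρ halfTwist)).natDegree := by
    by_contra! hlt
    have hpos := minpoly.natDegree_pos (Algebra.IsIntegral.isIntegral (R := K) (ρ halfTwist))
    obtain ⟨c, hc⟩ : ρ halfTwist ∈ (algebraMap K (End K V)).range :=
      minpoly.natDegree_eq_one_iff.1 (by lia)
    have htop : End.eigenspace (ρ halfTwist) c = ⊤ :=
      eq_top_iff.2 fun v _ => End.mem_eigenspace_iff.2 (LinearMap.congr_fun hc v).symm
    have hdisj := disjoint_eigenspace_of_closure_eq_top ρ closure_halfTwist_s1 (by lia) c μ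
    rw [htop, top_disjoint] at hdisj
    exact hμ hdisj
  have hdet := det_eq_of_pow_finrank_eq_smul_id (by rw [hd, h.halfTwist_sq]) hmin
  rw [det_halfTwist, hd, neg_one_sq, one_mul] at hdet
  rw [hdet, neg_neg]

theorem HasCentralScalar.eq_of_finrank_eq_three [ρ.IsIrreducible] (h : HasCentralScalar ρ δ)
    (hd : finrank K V = 3) : δ = LinearMap.det (ρ s1) ^ 2 := by
  have := nontrivial_of_isIrreducible ρ
  have : FiniteDimensional K V := .of_finrank_pos (by lia)
  have hmin : finrank K V ≤ (minpoly K (ρ rot)).natDegree := by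
    by_contra! hlt
    have hdeg : (minpoly K (ρ halfTwist)).natDegree ≤ 2 :=
      natDegree_minpoly_le_of_pow_eq_smul_id two_ne_zero h.halfTwist_sq
    obtain ⟨a, ha⟩ := exists_hasEigenvalue_of_natDegree_minpoly_lt hlt hd.le
    obtain ⟨b, hb⟩ := exists_hasEigenvalue_of_natDegree_minpoly_lt
      (f := ρ halfTwist) (by lia) hd.le
    obtain ⟨c, hc⟩ := exists_finrank_le_two_mul_finrank_eigenspace (by lia) ha
    obtain ⟨d, hd'⟩ := exists_finrank_le_two_mul_finrank_eigenspace hdeg hb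
    have hle := Submodule.finrank_add_finrank_le_of_disjoint
      (disjoint_eigenspace_of_closure_eq_top ρ closure_halfTwist_rot (by lia) d c)
    lia
  have hdet := det_eq_of_pow_finrank_eq_smul_id (by rw [hd, h.rot_pow_three]) hmin
  rw [det_rot, hd, Odd.neg_one_pow (by decide), neg_one_mul, neg_neg] at hdet
  exact hdet.symm

end CentralScalar

end B3Rep

theorem mainTheorem10 {K V : Type*} [Field K] [IsAlgClosed K]
    [AddCommGroup V] [Module K V] [FiniteDimensional K V] :
    -- the central scalar of a simple `B₃`-module is well defined
    (∀ ρ : Representation K B3Rep.B3 V, ρ.IsIrreducible →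
      (∃! δ : K, B3Rep.HasCentralScalar ρ δ) ∧
      ∀ δ : K, B3Rep.HasCentralScalar ρ δ →
        δ ^ Module.finrank K V = LinearMap.det (ρ B3Rep.s1) ^ 6) ∧
    -- simple `SL(2, ℤ)`-modules are the simple `B₃`-modules with `δ ^ 2 = 1`
    Set.BijOn (B3Rep.pullback B3Rep.toSL)
      {τ : Representation K SL(2, ℤ) V | τ.IsIrreducible}
      {ρ : Representation K B3Rep.B3 V | ρ.IsIrreducible ∧
        ∃ δ : K, B3Rep.HasCentralScalar ρ δ ∧ δ ^ 2 = 1} ∧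
    (∀ {W : Type*} [AddCommGroup W] [Module K W] [FiniteDimensional K W]
      (τ : Representation K SL(2, ℤ) V) (τ' : Representation K SL(2, ℤ) W),
      Nonempty (τ.Equiv τ') ↔
        Nonempty ((B3Rep.pullback B3Rep.toSL τ).Equiv (B3Rep.pullback B3Rep.toSL τ'))) ∧
    -- simple `PSL(2, ℤ)`-modules are the simple `B₃`-modules with `δ = 1`
    Set.BijOn (B3Rep.pullback B3Rep.toPSL)
      {τ : Representation K PSL(2, ℤ) V | τ.IsIrreducible}
      {ρ : Representation K B3Rep.B3 V | ρ.IsIrreducible ∧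
        ∃ δ : K, B3Rep.HasCentralScalar ρ δ ∧ δ = 1} ∧
    (∀ {W : Type*} [AddCommGroup W] [Module K W] [FiniteDimensional K W]
      (τ : Representation K PSL(2, ℤ) V) (τ' : Representation K PSL(2, ℤ) W),
      Nonempty (τ.Equiv τ') ↔
        Nonempty ((B3Rep.pullback B3Rep.toPSL τ).Equiv (B3Rep.pullback B3Rep.toPSL τ'))) ∧
    -- the value of `δ` in dimensions two and three
    (∀ ρ : Representation K B3Rep.B3 V, ρ.IsIrreducible →
      ∀ δ : K, B3Rep.HasCentralScalar ρ δ →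
        (Module.finrank K V = 2 → ∀ l₁ l₂ : K,
          (LinearMap.charpoly (ρ B3Rep.s1)).roots = {l₁, l₂} →
            δ = -(l₁ * l₂) ^ 3) ∧
        (Module.finrank K V = 3 → ∀ l₁ l₂ l₃ : K,
          (LinearMap.charpoly (ρ B3Rep.s1)).roots = {l₁, l₂, l₃} →
            δ = (l₁ * l₂ * l₃) ^ 2)) := by
  refine ⟨fun ρ hρ => ⟨B3Rep.existsUnique_hasCentralScalar ρ, fun δ hδ => hδ.pow_finrank⟩,
    B3Rep.bijOn_pullback_toSL, B3Rep.nonempty_equiv_pullback_iff B3Rep.toSL_surjective,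
    B3Rep.bijOn_pullback_toPSL, B3Rep.nonempty_equiv_pullback_iff B3Rep.toPSL_surjective,
    fun ρ hρ δ hδ => ⟨fun hd l₁ l₂ hl => ?_, fun hd l₁ l₂ l₃ hl => ?_⟩⟩
  · have := B3Rep.nontrivial_of_isIrreducible ρ
    obtain ⟨μ, hμ⟩ := Module.End.exists_eigenvalue (ρ B3Rep.s1)
    have hdet : LinearMap.det (ρ B3Rep.s1) = l₁ * l₂ := by
      rw [Module.End.det_eq_prod_roots_charpoly_of_splits (IsAlgClosed.splits _), hl]
      simp
    rw [hδ.eq_of_finrank_eq_two hμ hd, hdet]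
  · have hdet : LinearMap.det (ρ B3Rep.s1) = l₁ * l₂ * l₃ := by
      rw [Module.End.det_eq_prod_roots_charpoly_of_splits (IsAlgClosed.splits _), hl]
      simp [mul_assoc]
    rw [hδ.eq_of_finrank_eq_three hd, hdet]
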